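/- **Theorem A.** Let $n \ge 3$, let $K$ be a smooth function on $\mathbb{R}^n$, and let $u$ be a positive smooth solution of $$\Delta u + K u^{\frac{n+2}{n-2}} = 0 \quad \text{in } \mathbb{R}^n .$$ Assume that there are positive constants $a, b$ with $0 < a^2 \le K(x) \le b^2$ for all large $|x|$. Define $v$ on $\mathbb{R} \times S^{n-1}$ by $$v(s,\theta) = |x|^{\frac{n-2}{2}} u(x), \qquad |x| = e^s,\ \theta = x/|x| \in S^{n-1},$$ and for $r > 0$ put $$P(u,r) = \frac{n-2}{2n} \int_{B_o(r)} x \cdot \nabla K(x)\, u^{\frac{2n}{n-2}}(x)\, dx,$$ where $B_o(r)$ is the ball of radius $r$ centered at the origin. Assume that there exist positive constants $C_9$ and $C_{10}$ such that $$\int_{S^{n-1}} \left(\frac{\partial v}{\partial s}\right)^2 (s,\theta)\, d\theta \le C_9 + C_{10} \int_{S^{n-1}} v^2(s,\theta)\, d\theta$$ for all large $s$, and that there is a positive constant $\delta$ such that $P(u,r) \ge -\delta^2$ for all large $r$. Then there exist positive constants $C'$ and $C''$ such that $$\int_{B_o(r)} u^{\frac{2n}{n-2}}\, dx \le C' \ln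 r \qquad \text{and} \qquad \int_{B_o(r)} |\nabla u|^2\, dx \le C'' \ln r$$ for all large $r$. -/

import Mathlib

open MeasureTheory Filter
open scoped ContDiff InnerProductSpace Laplacian Gradient

noncomputable section

/-- `u` is a positive smooth solution of `Δu + K u^((n+2)/(n-2)) = 0` on all of `ℝⁿ`. -/
structure IsPositiveSmoothSolution {n : ℕ} (K u : EuclideanSpace ℝ (Fin n) → ℝ) : Prop where
  smooth : ContDiff ℝ ∞ u
  pos : ∀ x, 0 < u x
  eqn : ∀ x, Δ u x + K x * u x ^ (((n : ℝ) + 2) / ((n : ℝ) - 2)) = 0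

/-- The function `v (s, θ) = |x|^((n-2)/2) u(x)` on the cylinder `ℝ × S^(n-1)`,
where `x = e^s θ`, so that `|x| = e^s` and `θ = x / |x|`. -/
def cylinderFun {n : ℕ} (u : EuclideanSpace ℝ (Fin n) → ℝ) (s : ℝ)
    (θ : Metric.sphere (0 : EuclideanSpace ℝ (Fin n)) 1) : ℝ :=
  ‖Real.exp s • (θ : EuclideanSpace ℝ (Fin n))‖ ^ (((n : ℝ) - 2) / 2) *
    u (Real.exp s • (θ : EuclideanSpace ℝ (Fin n)))

/-- The surface measure `dθ` on the unit sphere `S^(n-1)`. -/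
abbrev surfaceMeasure (n : ℕ) : Measure (Metric.sphere (0 : EuclideanSpace ℝ (Fin n)) 1) :=
  (volume : Measure (EuclideanSpace ℝ (Fin n))).toSphere

/-- The Pohozaev quantity
`P(u, r) = (n-2)/(2n) ∫_{B_o(r)} x · ∇K(x) u(x)^(2n/(n-2)) dx`. -/
def pohozaev {n : ℕ} (K u : EuclideanSpace ℝ (Fin n) → ℝ) (r : ℝ) : ℝ :=
  ((n : ℝ) - 2) / (2 * (n : ℝ)) *
    ∫ x in Metric.ball (0 : EuclideanSpace ℝ (Fin n)) r,
      ⟪x, ∇ K x⟫_ℝ * u x ^ (2 * (n : ℝ) / ((n : ℝ) - 2))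

end

open Set Metric Topology

/-! Write s = ln r, q = 2n/(n-2), c = (n-2)/2, and over the unit sphere put U = ∫ v², A = ∫ v^q.
With F(s) the integral of u^q over the ball of radius e^s, F' = A. The equation multiplied by u
expresses U'' through U, U', ∫ K v^q and the spherical integral N of |∇u|² (scaled by r^n). The
Pohozaev identity, with P ≥ -δ², bounds N from above, and the two combine to U''/2 ≤ const + 2 ∫
v_s² - (2/n) ∫ K v^q for large s. The assumption on v_s, the bound K ≥ a² and the inequality U ≤ εA
+ C_ε (as q > 2) turn this into U''/2 ≤ C - κF'.

One integration gives U'/2 ≤ k + Cs - κF, hence U = O(s²). A second one over [s, 2s], where F ≥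
F(s), gives 0 ≤ U(2s)/2 ≤ O(s²) - κ s F(s), so F(s) = O(s). For the gradient, the same Pohozaev
bound and K ≤ b² give N ≤ c₀ + c₁A, which is integrated against the bound on F.

The identities rest on `hasDerivAt_flux_exp` and `divergence_pohozaevField`, the growth argument on
`eventually_le_mul_of_hasDerivAt`. -/

/-- The integral of `f` over the sphere of radius `|r|`, pulled back to the unit sphere. -/
noncomputable def sphereIntegral {n : ℕ} (f : EuclideanSpace ℝ (Fin n) → ℝ) (r : ℝ) : ℝ :=
  ∫ θ, f (r • (θ : EuclideanSpace ℝ (Fin n))) ∂(surfaceMeasure n)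

/-- The divergence of a vector field on `ℝⁿ`. -/
noncomputable def divergence {n : ℕ} (X : EuclideanSpace ℝ (Fin n) → EuclideanSpace ℝ (Fin n))
    (x : EuclideanSpace ℝ (Fin n)) : ℝ :=
  LinearMap.trace ℝ _ (fderiv ℝ X x : EuclideanSpace ℝ (Fin n) →ₗ[ℝ] EuclideanSpace ℝ (Fin n))

/-! ### Polar coordinates and differentiation in s = ln r. -/

section Polar

variable {n : ℕ}

local notation "E" => EuclideanSpace ℝ (Fin n)

lemma integrable_sphere_of_continuous {g : sphere (0 : E) 1 → ℝ} (hg : Continuous g) :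
    Integrable g (surfaceMeasure n) :=
  hg.integrable_of_hasCompactSupport (HasCompactSupport.of_compactSpace g)

lemma integrable_smul_sphere {f : E → ℝ} (hf : Continuous f) (r : ℝ) :
    Integrable (fun θ : sphere (0 : E) 1 => f (r • (θ : E))) (surfaceMeasure n) :=
  integrable_sphere_of_continuous (by fun_prop)

lemma continuous_sphereIntegral {f : E → ℝ} (hf : Continuous f) :
    Continuous (sphereIntegral f) := by
  have := continuous_parametric_integral_of_continuous (μ := surfaceMeasure n)
    (f := fun (r : ℝ) (θ : sphere (0 : E) 1) => f (r • (θ : E))) (by fun_prop) isCompact_univ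
  simp only [Measure.restrict_univ] at this
  exact this

lemma sphereIntegral_mono {f g : E → ℝ} (hf : Continuous f) (hg : Continuous g) {r : ℝ}
    (hr : 0 ≤ r) (h : ∀ x, ‖x‖ = r → f x ≤ g x) :
    sphereIntegral f r ≤ sphereIntegral g r := by
  refine integral_mono (integrable_smul_sphere hf r) (integrable_smul_sphere hg r) fun θ => ?_
  exact h _ (by rw [norm_smul, Real.norm_of_nonneg hr, norm_eq_of_mem_sphere, mul_one])

lemma sphereIntegral_add {f g : E → ℝ} (hf : Continuous f) (hg : Continuous g) (r : ℝ) :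
    sphereIntegral (fun x => f x + g x) r = sphereIntegral f r + sphereIntegral g r :=
  integral_add (integrable_smul_sphere hf r) (integrable_smul_sphere hg r)

lemma sphereIntegral_const_mul (c : ℝ) (f : E → ℝ) (r : ℝ) :
    sphereIntegral (fun x => c * f x) r = c * sphereIntegral f r :=
  integral_const_mul _ _

lemma sphereIntegral_congr {f g : E → ℝ} {r : ℝ} (hr : 0 ≤ r) (h : ∀ x, ‖x‖ = r → f x = g x) :
    sphereIntegral f r = sphereIntegral g r := by
  refine integral_congr_ae (.of_forall fun θ => h _ ?_)
  rw [norm_smul, Real.norm_of_nonneg hr, norm_eq_of_mem_sphere, mul_one]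

/-- Integration in polar coordinates. -/
lemma integral_eq_integral_sphereIntegral (hn : 0 < n) {f : E → ℝ} (hf : Integrable f) :
    ∫ x, f x = ∫ r in Ioi (0 : ℝ), r ^ (n - 1) * sphereIntegral f r := by
  have : Nonempty (Fin n) := ⟨⟨0, hn⟩⟩
  have hdim : Module.finrank ℝ E = n := by simp
  have hmp := (volume : Measure E).measurePreserving_homeomorphUnitSphereProd
  have hme := Homeomorph.measurableEmbedding (homeomorphUnitSphereProd E)
  set F : sphere (0 : E) 1 × Ioi (0 : ℝ) → ℝ := fun p => f ((p.2 : ℝ) • (p.1 : E)) with hF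
  have hcomp : ∀ x : ({0}ᶜ : Set E), F (homeomorphUnitSphereProd E x) = f x := by
    intro x
    have := congrArg Subtype.val ((homeomorphUnitSphereProd E).symm_apply_apply x)
    rw [homeomorphUnitSphereProd_symm_apply_coe] at this
    simp only [hF, this]
  have hint : Integrable F ((surfaceMeasure n).prod (.volumeIoiPow (n - 1))) := by
    have h1 := hmp.integrable_comp_emb (g := F) hme
    rw [hdim] at h1
    rw [surfaceMeasure, ← h1]
    have : F ∘ homeomorphUnitSphereProd E = f ∘ Subtype.val := funext hcomp
    rw [this, ← integrableOn_iff_comap_subtypeVal (measurableSet_singleton _).compl]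
    exact hf.integrableOn
  calc ∫ x, f x = ∫ x : ({(0)}ᶜ : Set E), f x ∂(volume.comap Subtype.val) := by
        rw [integral_subtype_comap (measurableSet_singleton _).compl f,
          restrict_compl_singleton]
    _ = ∫ p, F p ∂((surfaceMeasure n).prod (.volumeIoiPow (n - 1))) := by
        have := hmp.integral_comp hme F
        rw [hdim] at this
        rw [surfaceMeasure, ← this]
        simp only [hcomp]
    _ = ∫ r : Ioi (0 : ℝ), sphereIntegral f r ∂(.volumeIoiPow (n - 1)) := by
        rw [integral_prod_symm _ hint]; rfl
    _ = _ := by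
        simp only [Measure.volumeIoiPow, ENNReal.ofReal]
        rw [integral_withDensity_eq_integral_smul,
          integral_subtype_comap measurableSet_Ioi
            fun a ↦ Real.toNNReal (a ^ (n - 1)) • sphereIntegral f a,
          setIntegral_congr_fun measurableSet_Ioi fun x hx ↦ ?_]
        · rw [NNReal.smul_def, Real.coe_toNNReal _ (pow_nonneg hx.out.le _), smul_eq_mul]
        · exact (measurable_subtype_coe.pow_const _).real_toNNReal

lemma setIntegral_ball_eq (hn : 0 < n) {f : E → ℝ} (hf : Continuous f) {R : ℝ} (hR : 0 ≤ R) :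
    ∫ x in ball (0 : E) R, f x = ∫ r in (0 : ℝ)..R, r ^ (n - 1) * sphereIntegral f r := by
  have hi : Integrable ((ball (0 : E) R).indicator f) := by
    rw [integrable_indicator_iff measurableSet_ball]
    exact (hf.continuousOn.integrableOn_compact (isCompact_closedBall 0 R)).mono_set
      ball_subset_closedBall
  rw [← integral_indicator measurableSet_ball, integral_eq_integral_sphereIntegral hn hi,
    intervalIntegral.integral_of_le hR, integral_Ioc_eq_integral_Ioo,
    ← Ioi_inter_Iio, ← setIntegral_indicator measurableSet_Iio]
  refine setIntegral_congr_fun measurableSet_Ioi fun r (hr : 0 < r) => ?_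
  have hnorm : ∀ θ : sphere (0 : E) 1, ‖r • (θ : E)‖ = r := fun θ => by
    rw [norm_smul, Real.norm_of_nonneg hr.le, norm_eq_of_mem_sphere, mul_one]
  by_cases h : r < R
  · simp [sphereIntegral, indicator, h, hnorm]
  · simp [sphereIntegral, indicator, h, hnorm]

lemma hasDerivAt_setIntegral_ball_exp (hn : 0 < n) {f : E → ℝ} (hf : Continuous f) (s : ℝ) :
    HasDerivAt (fun t => ∫ x in ball (0 : E) (Real.exp t), f x)
      (Real.exp s ^ n * sphereIntegral f (Real.exp s)) s := by
  have hc : Continuous fun r : ℝ => r ^ (n - 1) * sphereIntegral f r :=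
    (continuous_pow _).mul (continuous_sphereIntegral hf)
  have h1 := (hc.integral_hasStrictDerivAt 0 (Real.exp s)).hasDerivAt.comp s (Real.hasDerivAt_exp s)
  have h2 : (fun t => ∫ x in ball (0 : E) (Real.exp t), f x) =
      (fun R => ∫ r in (0 : ℝ)..R, r ^ (n - 1) * sphereIntegral f r) ∘ Real.exp :=
    funext fun t => setIntegral_ball_eq hn hf (Real.exp_pos t).le
  rw [h2]
  refine h1.congr_deriv ?_
  -- The factor e^s from the chain rule raises the Jacobian power n - 1 to n.
  obtain ⟨m, rfl⟩ : ∃ m, n = m + 1 := ⟨n - 1, by omega⟩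
  simp only [Nat.add_sub_cancel, pow_succ]
  ring

lemma hasDerivAt_sphereIntegral_exp {f : E → ℝ} (hf : ContDiff ℝ 1 f) (s : ℝ) :
    HasDerivAt (fun t => sphereIntegral f (Real.exp t))
      (sphereIntegral (fun x => fderiv ℝ f x x) (Real.exp s)) s := by
  have hf' : Continuous (fderiv ℝ f) := hf.continuous_fderiv one_ne_zero
  have hcont : Continuous fun p : ℝ × sphere (0 : E) 1 =>
      fderiv ℝ f (Real.exp p.1 • (p.2 : E)) (Real.exp p.1 • (p.2 : E)) := by
    refine (hf'.comp ?_).clm_apply ?_ <;> fun_prop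
  obtain ⟨C, hC⟩ := ((isCompact_Icc (a := s - 1) (b := s + 1)).prod
    (isCompact_univ (X := sphere (0 : E) 1))).exists_bound_of_continuousOn hcont.continuousOn
  refine (hasDerivAt_integral_of_dominated_loc_of_deriv_le (s := Icc (s - 1) (s + 1))
    (bound := fun _ => C)
    (F := fun t (θ : sphere (0 : E) 1) => f (Real.exp t • (θ : E)))
    (F' := fun t (θ : sphere (0 : E) 1) => fderiv ℝ f (Real.exp t • (θ : E)) (Real.exp t • (θ : E)))
    (Icc_mem_nhds (by linarith) (by linarith)) ?_ ?_ ?_ ?_ (integrable_const _) ?_).2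
  · exact .of_forall fun t => (integrable_smul_sphere hf.continuous _).aestronglyMeasurable
  · exact integrable_smul_sphere hf.continuous _
  · exact (integrable_smul_sphere (hf'.clm_apply continuous_id) _).aestronglyMeasurable
  · exact .of_forall fun θ t ht => hC (t, θ) ⟨ht, mem_univ _⟩
  · refine .of_forall fun θ t _ => ?_
    exact ((hf.differentiable one_ne_zero _).hasFDerivAt.comp_hasDerivAt t
      ((Real.hasDerivAt_exp t).smul_const (θ : E)))

end Polar

/-! ### Divergence and flux through spheres. -/

section Divergence

variable {n : ℕ}

local notation "E" => EuclideanSpace ℝ (Fin n)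

lemma divergence_eq_sum (X : E → E) (x : E) :
    divergence X x = ∑ i, ⟪EuclideanSpace.basisFun (Fin n) ℝ i,
      fderiv ℝ X x (EuclideanSpace.basisFun (Fin n) ℝ i)⟫_ℝ :=
  LinearMap.trace_eq_sum_inner _ _

lemma continuous_divergence {X : E → E} (hX : ContDiff ℝ 1 X) : Continuous (divergence X) := by
  have := hX.continuous_fderiv one_ne_zero
  simp only [funext (divergence_eq_sum X)]
  fun_prop

lemma divergence_add {X Y : E → E} {x : E} (hX : DifferentiableAt ℝ X x)
    (hY : DifferentiableAt ℝ Y x) :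
    divergence (fun y => X y + Y y) x = divergence X x + divergence Y x := by
  simp [divergence, fderiv_fun_add hX hY]

lemma divergence_sub {X Y : E → E} {x : E} (hX : DifferentiableAt ℝ X x)
    (hY : DifferentiableAt ℝ Y x) :
    divergence (fun y => X y - Y y) x = divergence X x - divergence Y x := by
  simp [divergence, fderiv_fun_sub hX hY]

lemma divergence_smul {f : E → ℝ} {X : E → E} {x : E} (hf : DifferentiableAt ℝ f x)
    (hX : DifferentiableAt ℝ X x) :
    divergence (fun y => f y • X y) x = f x * divergence X x + fderiv ℝ f x (X x) := by
  simp [divergence, fderiv_fun_smul hf hX]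

lemma divergence_id (x : E) : divergence (fun y => y) x = n := by
  simp [divergence]

lemma integral_divergence_eq_zero {X : E → E} (hX : ContDiff ℝ 1 X) (hs : HasCompactSupport X) :
    ∫ x, divergence X x = 0 := by
  have hX' := hX.continuous_fderiv one_ne_zero
  have hs' : HasCompactSupport (fderiv ℝ X) := hs.fderiv ℝ
  simp only [divergence_eq_sum]
  have hint : ∀ e : E, Integrable fun x => ⟪e, fderiv ℝ X x e⟫_ℝ := fun e =>
    Continuous.integrable_of_hasCompactSupport (by fun_prop)
      (hs'.comp_left (g := fun T : E →L[ℝ] E => ⟪e, T e⟫_ℝ) (by simp))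
  rw [integral_finsetSum _ fun i _ => hint _]
  refine Finset.sum_eq_zero fun i _ => ?_
  set e := EuclideanSpace.basisFun (Fin n) ℝ i
  have hd : ∀ x, fderiv ℝ (fun y => ⟪e, X y⟫_ℝ) x e = ⟪e, fderiv ℝ X x e⟫_ℝ := fun x => by
    have := (hX.differentiable one_ne_zero x)
    rw [fderiv_inner_apply ℝ (by fun_prop) this]
    simp
  -- Integration by parts against the constant function 1, one coordinate at a time.
  have := integral_mul_fderiv_eq_neg_fderiv_mul_of_integrable (μ := (volume : Measure E))
    (f := fun _ : E => (1 : ℝ)) (g := fun y => ⟪e, X y⟫_ℝ) (v := e) (by simp)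
    (by simpa [hd] using hint e)
    (by
      simp only [one_mul]
      exact Continuous.integrable_of_hasCompactSupport (by fun_prop)
        (hs.comp_left (g := fun T : E => ⟪e, T⟫_ℝ) (by simp)))
    (fun x _ => by fun_prop)
    (fun x _ => (differentiableAt_const _).inner ℝ (hX.differentiable one_ne_zero x))
  simpa [hd] using this

/-- The integral over a centred sphere of the divergence of a tangential vector field vanishes. -/
lemma sphereIntegral_divergence_eq_zero (hn : 0 < n) {Y : E → E} (hY : ContDiff ℝ 1 Y)
    (hYt : ∀ x, ⟪x, Y x⟫_ℝ = 0) {r : ℝ} (hr : 0 < r) :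
    sphereIntegral (divergence Y) r = 0 := by
  have hJ := continuous_sphereIntegral (continuous_divergence hY)
  have hc : Continuous fun r : ℝ => r ^ (n - 1) * sphereIntegral (divergence Y) r :=
    (continuous_pow _).mul hJ
  -- Fundamental lemma of the calculus of variations in the radius, with radial test functions ψ(x)
  -- = g(|x|). Since ∇ψ is radial and Y tangential, div(ψY) = ψ div Y. Continuity then upgrades
  -- "almost every radius" to every radius.
  have hae := isOpen_Ioi.ae_eq_zero_of_integral_contDiff_smul_eq_zero (μ := (volume : Measure ℝ))
    (U := Ioi (0 : ℝ)) (f := fun r : ℝ => r ^ (n - 1) * sphereIntegral (divergence Y) r)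
    (hc.locallyIntegrable.locallyIntegrableOn _) ?_
  · have h0 := Measure.eqOn_open_of_ae_eq (μ := (volume : Measure ℝ)) (U := Ioi (0 : ℝ))
      (f := fun r : ℝ => r ^ (n - 1) * sphereIntegral (divergence Y) r) (g := fun _ => 0)
      ((ae_restrict_iff' measurableSet_Ioi).2 hae) isOpen_Ioi hc.continuousOn continuousOn_const
      hr
    exact (mul_eq_zero.1 h0).resolve_left (pow_pos hr _).ne'
  · intro g hg hgs hgU
    set ψ : E → ℝ := fun x => g ‖x‖ with hψ
    have hg0 : ∀ᶠ x : E in 𝓝 0, ψ x = 0 := by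
      have : ∀ᶠ t in 𝓝 (0 : ℝ), g t = 0 :=
        notMem_tsupport_iff_eventuallyEq.1 fun h => lt_irrefl (0 : ℝ) (hgU h)
      have hn0 : Tendsto (fun x : E => ‖x‖) (𝓝 0) (𝓝 0) := by
        simpa using continuous_norm.tendsto (0 : E)
      exact hn0.eventually this
    have hψc : ContDiff ℝ 1 ψ := by
      refine contDiff_iff_contDiffAt.2 fun x => ?_
      rcases eq_or_ne x 0 with rfl | hx
      · exact (contDiffAt_const (c := (0 : ℝ))).congr_of_eventuallyEq hg0
      · exact (hg.of_le (by simp)).contDiffAt.comp x (contDiffAt_norm ℝ hx)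
    have hψs : HasCompactSupport ψ := by
      obtain ⟨R, hR⟩ := hgs.isCompact.isBounded.subset_closedBall 0
      refine HasCompactSupport.intro (isCompact_closedBall (0 : E) R) fun x hx => ?_
      by_contra h
      exact hx (by simpa using hR (subset_tsupport _ h))
    have hψd : ∀ x, fderiv ℝ ψ x (Y x) = 0 := by
      intro x
      rcases eq_or_ne x 0 with rfl | hx
      · have : fderiv ℝ ψ 0 = 0 := by
          rw [EventuallyEq.fderiv_eq (f := fun _ => (0 : ℝ)) hg0]
          simp
        simp [this]
      -- Differentiating the norm as the square root of |x|² makes its derivative a visible multiple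
      -- of ⟪x, ·⟫, which kills Y.
      · have hsq := ((hasStrictFDerivAt_norm_sq x).hasFDerivAt).sqrt
          (by simpa using hx)
        simp only [Real.sqrt_sq (norm_nonneg _)] at hsq
        have h := ((hg.differentiable (by simp) ‖x‖).hasDerivAt.comp_hasFDerivAt x hsq).fderiv
        have h' : fderiv ℝ ψ x = _ := h
        rw [h']
        simp [hYt]
    have hdiv : ∀ x, divergence (fun y => ψ y • Y y) x = ψ x * divergence Y x := fun x => by
      rw [divergence_smul (hψc.differentiable one_ne_zero x) (hY.differentiable one_ne_zero x),
        hψd, add_zero]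
    have hI : Integrable fun x => ψ x * divergence Y x :=
      (hψc.continuous.mul (continuous_divergence hY)).integrable_of_hasCompactSupport
        hψs.mul_right
    have h0 : ∫ x, divergence (fun y => ψ y • Y y) x = 0 :=
      integral_divergence_eq_zero (hψc.smul hY) (hψs.smul_right)
    have h0' : ∫ x, ψ x * divergence Y x = 0 := by simpa only [← hdiv] using h0
    rw [integral_eq_integral_sphereIntegral hn hI] at h0'
    have hzero : ∀ t, t ∉ Ioi (0 : ℝ) →
        g t • (t ^ (n - 1) * sphereIntegral (divergence Y) t) = 0 := fun t ht => by
      rw [image_eq_zero_of_notMem_tsupport fun h => ht (hgU h), zero_smul]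
    rw [← setIntegral_eq_integral_of_forall_compl_eq_zero hzero]
    refine (setIntegral_congr_fun measurableSet_Ioi fun t (ht : 0 < t) => ?_).trans h0'
    have : sphereIntegral (fun x => ψ x * divergence Y x) t =
        g t * sphereIntegral (divergence Y) t := by
      rw [← sphereIntegral_const_mul]
      exact sphereIntegral_congr ht.le fun x hx => by simp [hψ, hx]
    simp only [this, smul_eq_mul]
    ring

/-- The divergence theorem on concentric spheres, in logarithmic radial coordinate. -/
lemma hasDerivAt_flux_exp (hn : 2 ≤ n) {X : E → E} (hX : ContDiff ℝ 1 X) (s : ℝ) :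
    HasDerivAt (fun t => Real.exp t ^ (n - 2) * sphereIntegral (fun x => ⟪x, X x⟫_ℝ) (Real.exp t))
      (Real.exp s ^ n * sphereIntegral (divergence X) (Real.exp s)) s := by
  have hXd := hX.differentiable one_ne_zero
  set f : E → ℝ := fun x => ⟪x, X x⟫_ℝ with hf
  have hfc : ContDiff ℝ 1 f := contDiff_id.inner ℝ hX
  have hfd := hfc.differentiable one_ne_zero
  have hderiv := ((Real.hasDerivAt_exp s).fun_pow (n - 2)).fun_mul (hasDerivAt_sphereIntegral_exp hfc s)
  -- |x|² times the tangential part of X. The vanishing spherical integral of its divergence trades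
  -- div X for f and its radial derivative.
  have hY : ContDiff ℝ 1 fun x => ‖x‖ ^ 2 • X x - f x • x :=
    ((contDiff_norm_sq ℝ).smul hX).sub (hfc.smul contDiff_id)
  have hdiv : ∀ x, divergence (fun x => ‖x‖ ^ 2 • X x - f x • x) x =
      ‖x‖ ^ 2 * divergence X x + (-((n : ℝ) - 2) * f x + -1 * fderiv ℝ f x x) := by
    intro x
    have hsq : DifferentiableAt ℝ (fun x : E => ‖x‖ ^ 2) x :=
      (contDiff_norm_sq ℝ (n := 1)).differentiable one_ne_zero x
    have hid : DifferentiableAt ℝ (fun y : E => y) x := differentiableAt_id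
    rw [divergence_sub (hsq.fun_smul (hXd x)) ((hfd x).fun_smul hid),
      divergence_smul hsq (hXd x), divergence_smul (hfd x) hid, divergence_id,
      fderiv_norm_sq_apply]
    simp [hf]
    ring
  have h0 := sphereIntegral_divergence_eq_zero (by omega) hY
    (fun x => by
      rw [inner_sub_right, inner_smul_right, inner_smul_right, real_inner_self_eq_norm_sq]
      ring) (Real.exp_pos s)
  have hfx : Continuous fun x => fderiv ℝ f x x :=
    (hfc.continuous_fderiv one_ne_zero).clm_apply continuous_id
  have hr : Continuous fun x => -((n : ℝ) - 2) * f x + -1 * fderiv ℝ f x x :=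
    (hfc.continuous.const_mul _).add (hfx.const_mul _)
  have h1 : sphereIntegral (divergence fun x => ‖x‖ ^ 2 • X x - f x • x) (Real.exp s) =
      Real.exp s ^ 2 * sphereIntegral (divergence X) (Real.exp s) +
        (-((n : ℝ) - 2) * sphereIntegral f (Real.exp s) +
          -1 * sphereIntegral (fun x => fderiv ℝ f x x) (Real.exp s)) := by
    rw [← sphereIntegral_const_mul, ← sphereIntegral_const_mul, ← sphereIntegral_const_mul,
      ← sphereIntegral_add (hfc.continuous.const_mul _) (hfx.const_mul _),
      ← sphereIntegral_add ((continuous_divergence hX).const_mul _) hr]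
    exact sphereIntegral_congr (Real.exp_pos s).le fun x hx => by rw [hdiv, hx]
  rw [h0] at h1
  refine hderiv.congr_deriv ?_
  have hpow : Real.exp s ^ n = Real.exp s ^ (n - 2) * Real.exp s ^ 2 := by
    rw [← pow_add]; congr 1; omega
  -- For n = 2 the exponent n - 2 - 1 truncates to 0, harmlessly, because the coefficient n - 2
  -- vanishes.
  have hpow' : ((n - 2 : ℕ) : ℝ) * Real.exp s ^ (n - 2 - 1) * Real.exp s =
      ((n : ℝ) - 2) * Real.exp s ^ (n - 2) := by
    obtain ⟨m, rfl⟩ : ∃ m, n = m + 2 := ⟨n - 2, by omega⟩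
    rcases m with _ | m
    · simp
    · simp only [Nat.add_sub_cancel, pow_succ]; push_cast; ring
  rw [hpow, hpow']
  linear_combination Real.exp s ^ (n - 2) * h1

end Divergence

/-! ### Gradient calculus and the Pohozaev field. -/

section Pohozaev

variable {n : ℕ}

local notation "E" => EuclideanSpace ℝ (Fin n)

lemma inner_gradient_eq_fderiv (u : E → ℝ) (x h : E) : ⟪h, ∇ u x⟫_ℝ = fderiv ℝ u x h := by
  rw [real_inner_comm, ← toDual_gradient, InnerProductSpace.toDual_apply_apply]

lemma contDiff_gradient {u : E → ℝ} (hu : ContDiff ℝ ∞ u) : ContDiff ℝ ∞ (∇ u) := by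
  refine contDiff_euclidean.2 fun i => ?_
  have : (fun x => ∇ u x i) = fun x => fderiv ℝ u x (EuclideanSpace.single i 1) := by
    funext x
    rw [← inner_gradient_eq_fderiv, EuclideanSpace.inner_single_left]
    simp
  rw [this]
  exact (hu.fderiv_right (m := ∞) (by simp)).clm_apply contDiff_const

lemma inner_fderiv_gradient {u : E → ℝ} (hu : ContDiff ℝ ∞ u) (x h k : E) :
    ⟪h, fderiv ℝ (∇ u) x k⟫_ℝ = fderiv ℝ (fderiv ℝ u) x k h := by
  have h1 : DifferentiableAt ℝ (∇ u) x := (contDiff_gradient hu).differentiable (by simp) x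
  have h2 : DifferentiableAt ℝ (fderiv ℝ u) x :=
    (hu.fderiv_right (m := ∞) (by simp)).differentiable (by simp) x
  have h3 := (hasFDerivAt_const h x).inner ℝ h1.hasFDerivAt
  have h4 := h2.hasFDerivAt.clm_apply (hasFDerivAt_const h x)
  have h5 : (fun y => ⟪h, ∇ u y⟫_ℝ) = fun y => fderiv ℝ u y h :=
    funext fun y => inner_gradient_eq_fderiv u y h
  rw [h5] at h3
  simpa using congrArg (fun T : E →L[ℝ] ℝ => T k) (h3.unique h4)

lemma divergence_gradient {u : E → ℝ} (hu : ContDiff ℝ ∞ u) (x : E) :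
    divergence (∇ u) x = Δ u x := by
  rw [divergence_eq_sum, InnerProductSpace.laplacian_eq_iteratedFDeriv_orthonormalBasis u
    (EuclideanSpace.basisFun (Fin n) ℝ)]
  refine Finset.sum_congr rfl fun i _ => ?_
  rw [inner_fderiv_gradient hu, iteratedFDeriv_two_apply]
  rfl

lemma divergence_smul_gradient_self {u : E → ℝ} (hu : ContDiff ℝ ∞ u) (x : E) :
    divergence (fun y => u y • ∇ u y) x = u x * Δ u x + ‖∇ u x‖ ^ 2 := by
  rw [divergence_smul (hu.differentiable (by simp) x)
    ((contDiff_gradient hu).differentiable (by simp) x), divergence_gradient hu,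
    ← inner_gradient_eq_fderiv, real_inner_self_eq_norm_sq]

/-- The Pohozaev vector field, whose divergence is `(1 / q) (x · ∇K) u ^ q` on solutions. -/
noncomputable def pohozaevField (c q : ℝ) (K u : E → ℝ) (x : E) : E :=
  (fderiv ℝ u x x + c * u x) • ∇ u x + (K x * u x ^ q / q - ‖∇ u x‖ ^ 2 / 2) • x

lemma contDiff_pohozaevField (c q : ℝ) {K u : E → ℝ} (hK : ContDiff ℝ ∞ K) (hu : ContDiff ℝ ∞ u)
    (hpos : ∀ x, 0 < u x) : ContDiff ℝ ∞ (pohozaevField c q K u) := by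
  have h1 : ContDiff ℝ ∞ (∇ u) := contDiff_gradient hu
  have h2 : ContDiff ℝ ∞ fun x => fderiv ℝ u x x :=
    (hu.fderiv_right (m := ∞) (by simp)).clm_apply contDiff_id
  have h3 : ContDiff ℝ ∞ fun x => u x ^ q := hu.rpow_const_of_ne fun x => (hpos x).ne'
  exact ((h2.add (contDiff_const.mul hu)).smul h1).add
    ((((hK.mul h3).div_const q).sub ((h1.norm_sq ℝ).div_const 2)).smul contDiff_id)

/-- The Hessian terms cancel by symmetry; the terms (x · ∇u) K u^p cancel through the equation. The
conditions on c are those that remove the rest: c + 1 = n/2 the multiples of |∇u|², and n/q = c the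
multiples of K u^q. -/
lemma divergence_pohozaevField {c q p : ℝ} (hq : q ≠ 0) (hp : p + 1 = q) (hc : c + 1 = n / 2)
    (hcq : n / q = c) {K u : E → ℝ} (hK : ContDiff ℝ ∞ K) (hu : ContDiff ℝ ∞ u)
    (hpos : ∀ x, 0 < u x) (heq : ∀ x, Δ u x + K x * u x ^ p = 0) (x : E) :
    divergence (pohozaevField c q K u) x = ⟪x, ∇ K x⟫_ℝ * u x ^ q / q := by
  have hu1 : HasFDerivAt u (fderiv ℝ u x) x := (hu.differentiable (by simp) x).hasFDerivAt
  have hK1 : HasFDerivAt K (fderiv ℝ K x) x := (hK.differentiable (by simp) x).hasFDerivAt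
  have hg1 : HasFDerivAt (∇ u) (fderiv ℝ (∇ u) x) x :=
    ((contDiff_gradient hu).differentiable (by simp) x).hasFDerivAt
  have hd1 : HasFDerivAt (fderiv ℝ u) (fderiv ℝ (fderiv ℝ u) x) x :=
    ((hu.fderiv_right (m := ∞) (by simp)).differentiable (by simp) x).hasFDerivAt
  have hsymm : fderiv ℝ (fderiv ℝ u) x (∇ u x) x = fderiv ℝ (fderiv ℝ u) x x (∇ u x) :=
    (hu.contDiffAt.isSymmSndFDerivAt (by simpa using ENat.LEInfty.out)) _ _
  have hx : HasFDerivAt (fun y : E => y) (ContinuousLinearMap.id ℝ E) x := hasFDerivAt_id x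
  have hF := (hd1.clm_apply hx).fun_add (hu1.const_mul c)
  have hG := ((hK1.fun_mul (hu1.rpow_const (p := q) (.inl (hpos x).ne'))).mul_const q⁻¹).fun_sub
    (hg1.norm_sq.mul_const (2⁻¹ : ℝ))
  simp only [← div_eq_mul_inv] at hG
  have hid := hx.differentiableAt
  unfold pohozaevField
  rw [divergence_add (hF.differentiableAt.fun_smul hg1.differentiableAt)
      (hG.differentiableAt.fun_smul hid),
    divergence_smul hF.differentiableAt hg1.differentiableAt,
    divergence_smul hG.differentiableAt hid, divergence_id, divergence_gradient hu]
  have hF' := hF.fderiv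
  have hG' := hG.fderiv
  rw [hF', hG', inner_gradient_eq_fderiv]
  have hgg : fderiv ℝ u x (∇ u x) = ‖∇ u x‖ ^ 2 := by
    rw [← inner_gradient_eq_fderiv, real_inner_self_eq_norm_sq]
  have hpow : u x ^ q = u x ^ p * u x := by
    rw [← hp, Real.rpow_add_one (hpos x).ne']
  have hq1 : q - 1 = p := by linarith
  simp [inner_fderiv_gradient hu, hsymm, hgg, hq1]
  have hΔ : Δ u x = -(K x * u x ^ p) := by linarith [heq x]
  have hnq : (n : ℝ) = c * q := by rw [← hcq]; field_simp
  rw [hΔ, hpow]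
  have hn2 : (n : ℝ) = 2 * (c + 1) := by linarith
  field_simp
  linear_combination 2 * u x * K x * u x ^ p * hnq - ‖∇ u x‖ ^ 2 * q * hn2

end Pohozaev

/-! ### One-variable growth estimates. -/

section Growth

lemma le_of_hasDerivAt_nonpos {f f' : ℝ → ℝ} {a b : ℝ} (hab : a ≤ b)
    (hf : ∀ x, HasDerivAt f (f' x) x) (hf' : ∀ x, a ≤ x → f' x ≤ 0) : f b ≤ f a := by
  have := antitoneOn_of_deriv_nonpos (convex_Ici a) (f := f)
    (fun x _ => (hf x).continuousAt.continuousWithinAt)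
    (fun x _ => (hf x).differentiableAt.differentiableWithinAt)
    (fun x hx => by
      rw [(hf x).deriv]
      exact hf' x (interior_subset hx))
  exact this self_mem_Ici hab hab

/-- A nonnegative U cannot stay concave too strongly: if F outgrew s, then U'' /2 ≤ C - κF' would
drive U below zero by time 2s. -/
lemma eventually_le_mul_of_hasDerivAt {F A U W W' : ℝ → ℝ} {κ C s₀ : ℝ} (hκ : 0 < κ)
    (hF : ∀ s, HasDerivAt F (A s) s) (hF0 : ∀ s, 0 ≤ F s) (hA : ∀ s, 0 ≤ A s)
    (hU : ∀ s, HasDerivAt U (2 * W s) s) (hU0 : ∀ s, 0 ≤ U s)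
    (hW : ∀ s, HasDerivAt W (W' s) s) (hW' : ∀ s, s₀ ≤ s → W' s ≤ C - κ * A s) :
    ∃ C' > 0, ∀ᶠ s in atTop, F s ≤ C' * s := by
  have hmono : Monotone F := monotone_of_hasDerivAt_nonneg hF hA
  set k := W s₀ + κ * F s₀ - C * s₀ with hk
  have h1 : ∀ s, s₀ ≤ s → W s + κ * F s - C * s ≤ k := fun s hs =>
    le_of_hasDerivAt_nonpos hs
      (fun x => (((hW x).fun_add ((hF x).const_mul κ)).fun_sub ((hasDerivAt_id x).const_mul C)))
      (fun x hx => by linarith [hW' x hx])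
  set m := U s₀ / 2 - k * s₀ - C / 2 * s₀ ^ 2 with hm
  have h2 : ∀ s, s₀ ≤ s → U s / 2 - k * s - C / 2 * s ^ 2 ≤ m := fun s hs =>
    le_of_hasDerivAt_nonpos hs
      (fun x => ((((hU x).div_const 2).fun_sub ((hasDerivAt_id x).const_mul k)).fun_sub
        ((hasDerivAt_pow 2 x).const_mul (C / 2))))
      (fun x hx => by
        have := mul_nonneg hκ.le (hF0 x)
        norm_num
        linarith [h1 x hx])
  have h3 : ∀ s, s₀ ≤ s → 0 ≤ s → κ * F s * s ≤ m + 2 * k * s + 2 * C * s ^ 2 := by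
    intro s hs hs0
    -- On [s, 2s] monotonicity lets F be replaced by the constant F(s); the bound then follows from
    -- U(2s) ≥ 0 and the quadratic bound `h2` at s.
    have := le_of_hasDerivAt_nonpos
      (f := fun t => U t / 2 - k * t - C / 2 * t ^ 2 + κ * F s * t) (a := s) (b := 2 * s)
      (by linarith)
      (fun x => (((((hU x).div_const 2).fun_sub ((hasDerivAt_id x).const_mul k)).fun_sub
        ((hasDerivAt_pow 2 x).const_mul (C / 2))).fun_add
          ((hasDerivAt_id x).const_mul (κ * F s))))
      (fun x hx => by
        have := mul_le_mul_of_nonneg_left (hmono hx) hκ.le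
        norm_num
        linarith [h1 x (hs.trans hx)])
    nlinarith [h2 s hs, hU0 (2 * s)]
  refine ⟨(|m| + 2 * |k| + 2 * |C| + 1) / κ, by positivity, ?_⟩
  filter_upwards [eventually_ge_atTop s₀, eventually_ge_atTop 1] with s hs hs1
  have h4 := h3 s hs (by linarith)
  have h5 : κ * F s * s ≤ (|m| + 2 * |k| + 2 * |C| + 1) * s * s := by
    nlinarith [mul_le_mul_of_nonneg_right (le_abs_self k) (by linarith : (0 : ℝ) ≤ s * 1),
      mul_le_mul_of_nonneg_right (le_abs_self C) (by positivity : (0 : ℝ) ≤ s * s),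
      le_abs_self m, abs_nonneg m, abs_nonneg k,
      mul_le_mul_of_nonneg_left (by nlinarith : s ≤ s * s) (abs_nonneg k),
      mul_le_mul_of_nonneg_left (by nlinarith : 1 ≤ s * s) (abs_nonneg m)]
  have h6 := le_of_mul_le_mul_right h5 (by linarith)
  rw [div_mul_eq_mul_div, le_div_iff₀ hκ]
  linarith

lemma eventually_le_mul_of_deriv_le {F A G N : ℝ → ℝ} {c₀ c₁ C' s₀ : ℝ}
    (hc₁ : 0 ≤ c₁) (hF : ∀ s, HasDerivAt F (A s) s) (hG : ∀ s, HasDerivAt G (N s) s)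
    (hN : ∀ s, s₀ ≤ s → N s ≤ c₀ + c₁ * A s) (hFC : ∀ᶠ s in atTop, F s ≤ C' * s) :
    ∃ C'' > 0, ∀ᶠ s in atTop, G s ≤ C'' * s := by
  set k := G s₀ - c₀ * s₀ - c₁ * F s₀
  have h1 : ∀ s, s₀ ≤ s → G s - c₀ * s - c₁ * F s ≤ k := fun s hs =>
    le_of_hasDerivAt_nonpos hs
      (fun x => (((hG x).fun_sub ((hasDerivAt_id x).const_mul c₀)).fun_sub ((hF x).const_mul c₁)))
      (fun x hx => by linarith [hN x hx])
  refine ⟨|k| + |c₀| + c₁ * |C'| + 1, by positivity, ?_⟩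
  filter_upwards [hFC, eventually_ge_atTop s₀, eventually_ge_atTop 1] with s hs hs0 hs1
  have h2 := h1 s hs0
  have h3 : F s ≤ |C'| * s := hs.trans (by gcongr; exact le_abs_self _)
  nlinarith [mul_le_mul_of_nonneg_left h3 hc₁, le_abs_self k,
    mul_le_mul_of_nonneg_right (le_abs_self c₀) (by linarith : (0 : ℝ) ≤ s),
    mul_le_mul_of_nonneg_left hs1 (abs_nonneg k)]

lemma exists_sq_le_rpow_add {q ε : ℝ} (hq : 2 < q) (hε : 0 < ε) :
    ∃ C, 0 ≤ C ∧ ∀ t : ℝ, 0 < t → t ^ 2 ≤ ε * t ^ q + C := by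
  -- T is the threshold where ε t^q = t²; below it t² ≤ T², above it the power q dominates.
  set T := ε⁻¹ ^ (q - 2)⁻¹ with hT
  have hT0 : 0 < T := by positivity
  refine ⟨T ^ 2, by positivity, fun t ht => ?_⟩
  rcases le_total t T with h | h
  · have : t ^ 2 ≤ T ^ 2 := by gcongr
    have : 0 < ε * t ^ q := by positivity
    linarith
  · have h1 : ε⁻¹ ≤ t ^ (q - 2) := by
      calc ε⁻¹ = T ^ (q - 2) := by
            rw [hT, ← Real.rpow_mul (by positivity), inv_mul_cancel₀ (by linarith), Real.rpow_one]
        _ ≤ t ^ (q - 2) := Real.rpow_le_rpow hT0.le h (by linarith)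
    have h2 : t ^ q = t ^ (q - 2) * t ^ 2 := by
      rw [← Real.rpow_natCast t 2, ← Real.rpow_add ht]
      norm_num
    have h3 : 1 ≤ ε * t ^ (q - 2) := by
      calc (1 : ℝ) = ε * ε⁻¹ := (mul_inv_cancel₀ hε.ne').symm
        _ ≤ _ := by gcongr
    rw [h2]
    nlinarith [mul_le_mul_of_nonneg_right h3 (sq_nonneg t), sq_nonneg T]

end Growth

/-! ### Cylindrical integrals in terms of u. -/

section Cylinder

variable {n : ℕ}

local notation "E" => EuclideanSpace ℝ (Fin n)

lemma norm_exp_smul_sphere (s : ℝ) (θ : sphere (0 : E) 1) :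
    ‖Real.exp s • (θ : E)‖ = Real.exp s := by
  rw [norm_smul, Real.norm_of_nonneg (Real.exp_pos s).le, norm_eq_of_mem_sphere, mul_one]

lemma rpow_half_sq (hn : 2 ≤ n) {r : ℝ} (hr : 0 < r) :
    (r ^ (((n : ℝ) - 2) / 2)) ^ 2 = r ^ (n - 2) := by
  rw [← Real.rpow_natCast, ← Real.rpow_mul hr.le, ← Real.rpow_natCast]
  congr 1
  push_cast [Nat.cast_sub hn]
  ring

lemma deriv_cylinderFun {u : E → ℝ} (hu : ContDiff ℝ ∞ u) (s : ℝ) (θ : sphere (0 : E) 1) :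
    deriv (fun t => cylinderFun u t θ) s = Real.exp s ^ (((n : ℝ) - 2) / 2) *
      (fderiv ℝ u (Real.exp s • (θ : E)) (Real.exp s • (θ : E)) +
        ((n : ℝ) - 2) / 2 * u (Real.exp s • (θ : E))) := by
  simp only [cylinderFun, norm_exp_smul_sphere]
  have h1 : HasDerivAt (fun t => u (Real.exp t • (θ : E)))
      (fderiv ℝ u (Real.exp s • (θ : E)) (Real.exp s • (θ : E))) s :=
    (hu.differentiable (by simp) _).hasFDerivAt.comp_hasDerivAt s
      ((Real.hasDerivAt_exp s).smul_const (θ : E))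
  have h2 := ((hasDerivAt_id s).mul_const (((n : ℝ) - 2) / 2)).exp
  simp only [id, one_mul, Real.exp_mul] at h2
  rw [(h2.fun_mul h1).deriv]
  ring

lemma integral_cylinderFun_sq (hn : 2 ≤ n) (u : E → ℝ) (s : ℝ) :
    ∫ θ, (cylinderFun u s θ) ^ 2 ∂(surfaceMeasure n) =
      Real.exp s ^ (n - 2) * sphereIntegral (fun x => u x ^ 2) (Real.exp s) := by
  simp only [cylinderFun, norm_exp_smul_sphere, mul_pow, rpow_half_sq hn (Real.exp_pos s),
    sphereIntegral, integral_const_mul]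

lemma integral_deriv_cylinderFun_sq (hn : 2 ≤ n) {u : E → ℝ} (hu : ContDiff ℝ ∞ u) (s : ℝ) :
    ∫ θ, (deriv (fun t => cylinderFun u t θ) s) ^ 2 ∂(surfaceMeasure n) =
      Real.exp s ^ (n - 2) * sphereIntegral
        (fun x => (fderiv ℝ u x x + ((n : ℝ) - 2) / 2 * u x) ^ 2) (Real.exp s) := by
  simp only [deriv_cylinderFun hu, mul_pow, rpow_half_sq hn (Real.exp_pos s),
    sphereIntegral, integral_const_mul]

end Cylinder

/-! ### The differential inequality for U and the conclusion. -/

theorem theoremA {n : ℕ} (hn : 3 ≤ n) (K u : EuclideanSpace ℝ (Fin n) → ℝ)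
    (hK : ContDiff ℝ ∞ K) (hu : IsPositiveSmoothSolution K u)
    (a b : ℝ) (ha : 0 < a) (hb : 0 < b)
    (hKab : ∀ᶠ x in Bornology.cobounded (EuclideanSpace ℝ (Fin n)), a ^ 2 ≤ K x ∧ K x ≤ b ^ 2)
    (C₉ C₁₀ : ℝ) (hC₉ : 0 < C₉) (hC₁₀ : 0 < C₁₀)
    (hv : ∀ᶠ s : ℝ in atTop,
      ∫ θ, (deriv (fun t => cylinderFun u t θ) s) ^ 2 ∂(surfaceMeasure n) ≤
        C₉ + C₁₀ * ∫ θ, (cylinderFun u s θ) ^ 2 ∂(surfaceMeasure n))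
    (δ : ℝ) (hδ : 0 < δ)
    (hP : ∀ᶠ r : ℝ in atTop, -δ ^ 2 ≤ pohozaev K u r) :
    ∃ C' > 0, ∃ C'' > 0, ∀ᶠ r : ℝ in atTop,
      (∫ x in Metric.ball (0 : EuclideanSpace ℝ (Fin n)) r,
          u x ^ (2 * (n : ℝ) / ((n : ℝ) - 2)) ≤ C' * Real.log r) ∧
      (∫ x in Metric.ball (0 : EuclideanSpace ℝ (Fin n)) r,
          ‖∇ u x‖ ^ 2 ≤ C'' * Real.log r) := by
  obtain ⟨hsm, hpos, heqn⟩ := hu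
  have hn3 : (3 : ℝ) ≤ n := by exact_mod_cast hn
  have hn2 : 2 ≤ n := by omega
  have hn0 : 0 < n := by omega
  simp only [integral_cylinderFun_sq hn2, integral_deriv_cylinderFun_sq hn2 hsm] at hv
  set q : ℝ := 2 * (n : ℝ) / ((n : ℝ) - 2) with hq
  set p : ℝ := ((n : ℝ) + 2) / ((n : ℝ) - 2) with hp
  set c : ℝ := ((n : ℝ) - 2) / 2 with hc
  have hm : (n : ℝ) - 2 ≠ 0 := by linarith
  have hm0 : 0 < (n : ℝ) - 2 := by linarith
  have hpq : p + 1 = q := by rw [hp, hq]; field_simp; ring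
  have hcn : c + 1 = n / 2 := by rw [hc]; ring
  have hcq : n / q = c := by rw [hc, hq]; field_simp
  have hq2 : 2 < q := by rw [hq, lt_div_iff₀ hm0]; linarith
  have hc0 : 0 < c := by rw [hc]; linarith
  have hqc : c * q = n := by rw [hc, hq]; field_simp
  have hq1n : 1 / q = ((n : ℝ) - 2) / (2 * n) := by rw [hq]; field_simp
  -- continuity and smoothness of the integrands
  have hcu : Continuous u := hsm.continuous
  have hcK : Continuous K := hK.continuous
  have hcg : Continuous (∇ u) := (contDiff_gradient hsm).continuous
  have hcgK : Continuous (∇ K) := (contDiff_gradient hK).continuous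
  have hcD : Continuous fun x => fderiv ℝ u x x :=
    (hsm.continuous_fderiv (by simp)).clm_apply continuous_id
  have hcq' : Continuous fun x => u x ^ q := hcu.rpow_const fun x => .inl (hpos x).ne'
  have huq : ∀ x, 0 < u x ^ q := fun x => Real.rpow_pos_of_pos (hpos x) q
  have huu : ∀ x, u x ^ q = u x * u x ^ p := fun x => by
    rw [← hpq, Real.rpow_add_one (hpos x).ne', mul_comm]
  -- the spherical integrals in the logarithmic radial coordinate
  set A : ℝ → ℝ := fun s => Real.exp s ^ n * sphereIntegral (fun x => u x ^ q) (Real.exp s)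
    with hA
  set N : ℝ → ℝ := fun s => Real.exp s ^ n * sphereIntegral (fun x => ‖∇ u x‖ ^ 2) (Real.exp s)
    with hN
  set B : ℝ → ℝ := fun s => Real.exp s ^ n * sphereIntegral (fun x => K x * u x ^ q) (Real.exp s)
    with hB
  set U : ℝ → ℝ := fun s => Real.exp s ^ (n - 2) * sphereIntegral (fun x => u x ^ 2) (Real.exp s)
    with hU
  set Z : ℝ → ℝ := fun s => Real.exp s ^ (n - 2) *
    sphereIntegral (fun x => u x * fderiv ℝ u x x) (Real.exp s) with hZ
  set Q : ℝ → ℝ := fun s => Real.exp s ^ (n - 2) *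
    sphereIntegral (fun x => (fderiv ℝ u x x) ^ 2) (Real.exp s) with hQ
  have hpow : ∀ s, Real.exp s ^ n = Real.exp s ^ (n - 2) * Real.exp s ^ 2 := fun s => by
    rw [← pow_add]; congr 1; omega
  have hnonneg : ∀ (f : EuclideanSpace ℝ (Fin n) → ℝ) (m : ℕ) (s : ℝ), (∀ x, 0 ≤ f x) →
      0 ≤ Real.exp s ^ m * sphereIntegral f (Real.exp s) := fun f m s hf =>
    mul_nonneg (by positivity) (integral_nonneg fun θ => hf _)
  have hA0 : ∀ s, 0 ≤ A s := fun s => hnonneg _ _ _ fun x => (huq x).le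
  have hU0 : ∀ s, 0 ≤ U s := fun s => hnonneg _ _ _ fun x => sq_nonneg _
  -- k = c gives ∫ v_s²; k = 3c/2 supplies a nonnegative square for the gradient estimate.
  have hV : ∀ k s, Real.exp s ^ (n - 2) * sphereIntegral
      (fun x => (fderiv ℝ u x x + k * u x) ^ 2) (Real.exp s) = Q s + 2 * k * Z s + k ^ 2 * U s := by
    intro k s
    have : (fun x => (fderiv ℝ u x x + k * u x) ^ 2) = fun x => (fderiv ℝ u x x) ^ 2 +
        (2 * k * (u x * fderiv ℝ u x x) + k ^ 2 * u x ^ 2) := by funext x; ring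
    rw [this, sphereIntegral_add (by fun_prop) (by fun_prop),
      sphereIntegral_add (by fun_prop) (by fun_prop), sphereIntegral_const_mul,
      sphereIntegral_const_mul]
    ring
  simp only [hV] at hv
  -- derivatives
  have hU' : ∀ s, HasDerivAt U (2 * (c * U s + Z s)) s := by
    intro s
    have h1 := ((Real.hasDerivAt_exp s).fun_pow (n - 2)).fun_mul
      (hasDerivAt_sphereIntegral_exp ((hsm.of_le (by simp)).pow 2 : ContDiff ℝ 1 _) s)
    refine h1.congr_deriv ?_
    have h2 : ∀ x, fderiv ℝ (fun x => u x ^ 2) x x = 2 * (u x * fderiv ℝ u x x) := fun x => by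
      rw [fderiv_fun_pow 2 (hsm.differentiable (by simp) x)]
      simp
      ring
    have h3 : ((n - 2 : ℕ) : ℝ) * Real.exp s ^ (n - 2 - 1) * Real.exp s =
        2 * c * Real.exp s ^ (n - 2) := by
      obtain ⟨m, rfl⟩ : ∃ m, n = m + 3 := ⟨n - 3, by omega⟩
      have : m + 3 - 2 = m + 1 := by omega
      rw [this, hc]
      simp only [Nat.add_sub_cancel, pow_succ]; push_cast; ring
    simp only [h2, sphereIntegral_const_mul, h3, hU, hZ]
    ring
  have hZ' : ∀ s, HasDerivAt Z (N s - B s) s := by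
    intro s
    have h1 := hasDerivAt_flux_exp (X := fun x => u x • ∇ u x) hn2
      ((hsm.smul (contDiff_gradient hsm)).of_le (by simp)) s
    have h2 : (fun x => ⟪x, u x • ∇ u x⟫_ℝ) = fun x => u x * fderiv ℝ u x x := by
      funext x
      rw [inner_smul_right, inner_gradient_eq_fderiv]
    have h3 : (divergence fun x => u x • ∇ u x) =
        fun x => ‖∇ u x‖ ^ 2 + (-1) * (K x * u x ^ q) := by
      funext x
      rw [divergence_smul_gradient_self hsm, huu]
      linear_combination u x * heqn x
    rw [h2, h3, sphereIntegral_add (by fun_prop) (by fun_prop), sphereIntegral_const_mul] at h1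
    refine h1.congr_deriv ?_
    simp only [hN, hB]
    ring
  have hF' := fun s => hasDerivAt_setIntegral_ball_exp hn0 hcq' s
  have hG' := fun s => hasDerivAt_setIntegral_ball_exp (f := fun x => ‖∇ u x‖ ^ 2) hn0
    (by fun_prop) s
  -- the Pohozaev identity
  have hflux : ∀ s, HasDerivAt (fun s => Q s + c * Z s + B s / q - N s / 2)
      (Real.exp s ^ n * sphereIntegral (fun x => ⟪x, ∇ K x⟫_ℝ * u x ^ q / q) (Real.exp s)) s := by
    intro s
    have h1 := hasDerivAt_flux_exp hn2 ((contDiff_pohozaevField c q hK hsm hpos).of_le (by simp)) s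
    have h2 : divergence (pohozaevField c q K u) = fun x => ⟪x, ∇ K x⟫_ℝ * u x ^ q / q :=
      funext fun x =>
        divergence_pohozaevField (by linarith) hpq hcn hcq hK hsm hpos heqn x
    rw [h2] at h1
    refine h1.congr_of_eventuallyEq (.of_forall fun t => ?_)
    have h3 : sphereIntegral (fun x => ⟪x, pohozaevField c q K u x⟫_ℝ) (Real.exp t) =
        sphereIntegral (fun x => (fderiv ℝ u x x) ^ 2 + (c * (u x * fderiv ℝ u x x) +
          (Real.exp t ^ 2 / q * (K x * u x ^ q) + -(Real.exp t ^ 2 / 2) * ‖∇ u x‖ ^ 2)))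
          (Real.exp t) := by
      refine sphereIntegral_congr (Real.exp_pos t).le fun x hx => ?_
      rw [pohozaevField, inner_add_right, inner_smul_right, inner_smul_right,
        inner_gradient_eq_fderiv, real_inner_self_eq_norm_sq, hx]
      ring
    beta_reduce
    rw [h3, sphereIntegral_add (by fun_prop) (by fun_prop),
      sphereIntegral_add (by fun_prop) (by fun_prop),
      sphereIntegral_add (by fun_prop) (by fun_prop), sphereIntegral_const_mul,
      sphereIntegral_const_mul, sphereIntegral_const_mul]
    simp only [hQ, hZ, hB, hN, hpow]
    ring
  have hpoh : ∀ s, HasDerivAt (fun s => pohozaev K u (Real.exp s))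
      (Real.exp s ^ n * sphereIntegral (fun x => ⟪x, ∇ K x⟫_ℝ * u x ^ q / q) (Real.exp s)) s := by
    intro s
    have h1 := (hasDerivAt_setIntegral_ball_exp (f := fun x => ⟪x, ∇ K x⟫_ℝ * u x ^ q) hn0
      (by fun_prop) s).const_mul (((n : ℝ) - 2) / (2 * n))
    refine h1.congr_deriv ?_
    have : (fun x => ⟪x, ∇ K x⟫_ℝ * u x ^ q / q) =
        fun x => (1 / q) * (⟪x, ∇ K x⟫_ℝ * u x ^ q) := by funext x; ring
    rw [this, sphereIntegral_const_mul, hq1n]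
    ring
  -- Both sides have the same s-derivative; the value of the constant d is not needed.
  obtain ⟨d, hd⟩ : ∃ d, ∀ s,
      Q s + c * Z s + B s / q - N s / 2 = pohozaev K u (Real.exp s) + d := by
    have h1 : ∀ s, HasDerivAt (fun s => (Q s + c * Z s + B s / q - N s / 2) -
        pohozaev K u (Real.exp s)) 0 s := fun s =>
      ((hflux s).fun_sub (hpoh s)).congr_deriv (sub_self _)
    refine ⟨(Q 0 + c * Z 0 + B 0 / q - N 0 / 2) - pohozaev K u (Real.exp 0), fun s => ?_⟩
    have := is_const_of_deriv_eq_zero (fun s => (h1 s).differentiableAt) (fun s => (h1 s).deriv) s 0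
    linarith
  -- bounds valid for large `s`
  have hKs : ∀ᶠ s in atTop, a ^ 2 * A s ≤ B s ∧ B s ≤ b ^ 2 * A s := by
    have h1 : ∀ᶠ r : ℝ in atTop, ∀ x : EuclideanSpace ℝ (Fin n), r ≤ ‖x‖ →
        a ^ 2 ≤ K x ∧ K x ≤ b ^ 2 := by
      obtain ⟨r, -, hr⟩ := (hasBasis_cobounded_norm).eventually_iff.1 hKab
      filter_upwards [eventually_ge_atTop r] with t ht x hx using hr (ht.trans hx)
    filter_upwards [Real.tendsto_exp_atTop.eventually h1] with s hs
    constructor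
    · have := sphereIntegral_mono (f := fun x => a ^ 2 * u x ^ q) (g := fun x => K x * u x ^ q)
        (by fun_prop) (by fun_prop) (Real.exp_pos s).le
        (fun x hx => mul_le_mul_of_nonneg_right (hs x hx.ge).1 (huq x).le)
      rw [sphereIntegral_const_mul] at this
      have := mul_le_mul_of_nonneg_left this (pow_nonneg (Real.exp_pos s).le n)
      simp only [hA, hB]
      linarith
    · have := sphereIntegral_mono (f := fun x => K x * u x ^ q) (g := fun x => b ^ 2 * u x ^ q)
        (by fun_prop) (by fun_prop) (Real.exp_pos s).le
        (fun x hx => mul_le_mul_of_nonneg_right (hs x hx.ge).2 (huq x).le)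
      rw [sphereIntegral_const_mul] at this
      have := mul_le_mul_of_nonneg_left this (pow_nonneg (Real.exp_pos s).le n)
      simp only [hA, hB]
      linarith
  have hUA : ∀ ε > 0, ∃ C, 0 ≤ C ∧ ∀ s, U s ≤ ε * A s + C := by
    intro ε hε
    obtain ⟨C, hC0, hC⟩ := exists_sq_le_rpow_add hq2 hε
    refine ⟨C * (surfaceMeasure n).real univ, by positivity, fun s => ?_⟩
    have h1 : ∀ x, Real.exp s ^ (n - 2) * u x ^ 2 ≤ ε * Real.exp s ^ n * u x ^ q + C := by
      intro x
      -- Here t = e^{cs} u is v itself, and cq = n gives t^q = e^{ns} u^q.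
      have h2 := hC (Real.exp s ^ c * u x) (mul_pos (by positivity) (hpos x))
      rw [mul_pow, rpow_half_sq hn2 (Real.exp_pos s),
        Real.mul_rpow (by positivity) (hpos x).le, ← Real.rpow_mul (Real.exp_pos s).le, hqc,
        Real.rpow_natCast] at h2
      linarith
    have h3 := sphereIntegral_mono (f := fun x => Real.exp s ^ (n - 2) * u x ^ 2)
      (g := fun x => ε * Real.exp s ^ n * u x ^ q + C)
      (by fun_prop) (by fun_prop) (Real.exp_pos s).le (fun x _ => h1 x)
    rw [sphereIntegral_add (by fun_prop) (by fun_prop), sphereIntegral_const_mul,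
      sphereIntegral_const_mul] at h3
    have h4 : sphereIntegral (fun _ : EuclideanSpace ℝ (Fin n) => C) (Real.exp s) =
        C * (surfaceMeasure n).real univ := by
      simp [sphereIntegral, mul_comm]
    rw [h4] at h3
    simp only [hU, hA]
    linarith
  -- Since B ≥ a²A, the term (2/n)B is at least 2κA. One κA absorbs 2C₁₀U, whence ε = κ/(2C₁₀)
  -- below; the other remains.
  set κ : ℝ := a ^ 2 / n with hκ
  have hκ0 : 0 < κ := by positivity
  obtain ⟨M, hM0, hM⟩ := hUA (κ / (2 * C₁₀)) (by positivity)
  obtain ⟨M₁, hM₁0, hM₁⟩ := hUA 1 one_pos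
  have hEs : ∀ᶠ s in atTop, N s ≤ 2 * (δ ^ 2 + |d|) + 2 * (Q s + c * Z s) + 2 / q * B s := by
    filter_upwards [Real.tendsto_exp_atTop.eventually hP] with s hs
    have h1 := hd s
    have h2 := neg_abs_le d
    have h3 : 2 / q * B s = 2 * (B s / q) := by ring
    rw [h3]
    linarith
  have hW : ∀ s, HasDerivAt (fun s => c * U s + Z s) (c * (2 * (c * U s + Z s)) + (N s - B s)) s :=
    fun s => ((hU' s).const_mul c).fun_add (hZ' s)
  obtain ⟨s₀, hs₀⟩ := eventually_atTop.1 (hv.and (hKs.and hEs))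
  -- With W = cU + Z = U'/2, inserting `hEs` in W' completes the square 2(Q + 2cZ + c²U) = 2 ∫ v_s²
  -- and leaves -(1 - 2/q)B = -(2/n)B.
  obtain ⟨C', hC'0, hC'⟩ := eventually_le_mul_of_hasDerivAt (s₀ := s₀)
    (C := 2 * (δ ^ 2 + |d|) + 2 * C₉ + 2 * C₁₀ * M) hκ0 hF'
    (fun s => integral_nonneg fun x => (huq x).le) hA0 hU' hU0 hW
    (fun s hs => by
      obtain ⟨h1, ⟨h2, -⟩, h3⟩ := hs₀ s hs
      have h4 := mul_le_mul_of_nonneg_left (hM s) (by positivity : (0 : ℝ) ≤ 2 * C₁₀)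
      have h5 : 2 * C₁₀ * (κ / (2 * C₁₀) * A s + M) = κ * A s + 2 * C₁₀ * M := by field_simp
      have h6 : 2 / q = 1 - 2 / n := by rw [hq]; field_simp
      have h7 : 2 * (κ * A s) ≤ 2 / n * B s := by
        calc 2 * (κ * A s) = 2 / n * (a ^ 2 * A s) := by rw [hκ]; ring
          _ ≤ _ := by gcongr
      rw [h6] at h3
      change _ ≤ _ - κ * A s
      linarith)
  obtain ⟨C'', hC''0, hC''⟩ := eventually_le_mul_of_deriv_le (s₀ := s₀)
    (c₀ := 2 * (δ ^ 2 + |d|) + 4 * C₉ + (4 * C₁₀ + 2 * c ^ 2) * M₁)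
    (c₁ := 4 * C₁₀ + 2 * c ^ 2 + 2 / q * b ^ 2)
    (by have : 0 < q := by linarith
        positivity) hF' hG'
    (fun s hs => by
      obtain ⟨h1, ⟨-, h2⟩, h3⟩ := hs₀ s hs
      have hq0 : 0 < q := by linarith
      have h4 := mul_le_mul_of_nonneg_left (hM₁ s) (by positivity : 0 ≤ 4 * C₁₀ + 2 * c ^ 2)
      have h5 := mul_le_mul_of_nonneg_left h2 (by positivity : 0 ≤ 2 / q)
      -- This square yields 2(Q + cZ) ≤ 4(Q + 2cZ + c²U) + 2c²U: the difference is twice it plus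
      -- (3/2)c²U.
      have h6 : 0 ≤ Q s + 2 * (3 / 2 * c) * Z s + (3 / 2 * c) ^ 2 * U s := by
        rw [← hV]
        exact hnonneg _ _ _ fun x => sq_nonneg _
      have h7 : 0 ≤ c ^ 2 * U s := mul_nonneg (sq_nonneg c) (hU0 s)
      change N s ≤ _ + _ * A s
      change _ ≤ C₉ + C₁₀ * U s at h1
      linarith) hC'
  refine ⟨C', hC'0, C'', hC''0, ?_⟩
  filter_upwards [Real.tendsto_log_atTop.eventually hC', Real.tendsto_log_atTop.eventually hC'',
    eventually_gt_atTop 0] with r h1 h2 hr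
  rw [Real.exp_log hr] at h1 h2
  exact ⟨h1, h2⟩
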